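/- Notation. For $n\ge 0$ let $P_n^{(\alpha,\beta)}(x)=\sum_{l=0}^{n}\frac{(n+\alpha+\beta+1)_l\,(\alpha+l+1)_{n-l}}{l!\,(n-l)!}\left(\frac{x-1}{2}\right)^l$ be the Jacobi polynomials, where $(c)_k$ denotes the rising factorial. Write $\mathbf{x}=(x,y)\in\mathbb{R}^2$, $x=r\cos\theta$, $y=r\sin\theta$, $\rho(\theta)=\begin{pmatrix}\cos\theta&-\sin\theta\\ \sin\theta&\cos\theta\end{pmatrix}$, and for $\mathbf{f}=(f_1,f_2)$ let $\operatorname{curl}\mathbf{f}=\partial_x f_2-\partial_y f_1$. For $m\in\mathbb{Z}$, $j\ge 0$ the standard Zernike polynomials are $$z_{mj}(\mathbf{x})=P_j^{(0,|m|)}(2r^2-1)\,(x+i\,\mathrm{sign}(m)\,y)^{|m|}.$$ For an integer $n\ge 0$ and real $b\ge 0$ put $$\mathfrak{r}_n^{(b)}=10n^2+n(13b+19)+4(b+1)(b+2),$$ $$\mathbf{v}_n^{(b)}(t)=\begin{pmatrix}(b+1)(1-t)P_n^{(1,b+1)}(2t-1)-2t(n+1)P_n^{(0,b+2)}(2t-1)\\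 (b+1)P_n^{(1,b+1)}(2t-1)\end{pmatrix},$$ $$\mathbf{q}_n^{(b),1}(t)=\frac{2n+b+1}{(n+1)\mathfrak{r}_n^{(b)}}\left[(2n+b+2)(2n+b+3)P_n^{(1,b)}(2t-1)\begin{pmatrix}1-t\\1\end{pmatrix}-(n+b+2)\mathbf{v}_n^{(b)}(t)\right],$$ $$\mathbf{q}_n^{(b),2}(t)=-\frac{1}{n}\mathbf{v}_{n-1}^{(b)}(t)-\mathbf{q}_n^{(b),1}(t)\quad(n\ge 1).$$ Let $N(x,y)=\begin{pmatrix}1-y^2&xy\\xy&1-x^2\end{pmatrix}$ and, for $\nu\in\{1,2\}$, let $\mathbf{n}_{mj}^{\nu}=N\,\mathbf{v}_{mj}^{N,\nu}$, where for $j\ge 1$ $$\mathbf{v}_{0j}^{N,1}(\mathbf{x})=P_{j-1}^{(0,1)}(2r^2-1)\begin{pmatrix}x\\y\end{pmatrix},\qquad \mathbf{v}_{0j}^{N,2}(\mathbf{x})=P_{j-1}^{(1,1)}(2r^2-1)\begin{pmatrix}-y\\x\end{pmatrix},$$ and for $m\ne 0$ (with $j\ge 0$ if $\nu=1$ and $j\ge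 1$ if $\nu=2$) $$\mathbf{v}_{mj}^{N,\nu}(\mathbf{x})=r^{|m|-1}e^{im\theta}\rho(\theta)\begin{pmatrix}1&0\\0&i\,\mathrm{sign}(m)\end{pmatrix}\mathbf{q}_j^{(|m|-1),\nu}(r^2).$$ Finally set $$\mathbf{n}_{0j}^{+}=2\mathbf{n}_{0j}^{1},\quad \mathbf{n}_{0j}^{-}=2\mathbf{n}_{0j}^{2}\ (j\ge 1),\qquad \mathbf{n}_{m0}^{-}=2\mathbf{n}_{m0}^{1}\ (m\ne 0),\qquad \mathbf{n}_{mj}^{\pm}=\mathbf{n}_{mj}^{1}\pm\mathbf{n}_{mj}^{2}\ (m\ne 0,\ j\ge 1).$$ Theorem 7. The vector fields $\mathbf{n}_{mj}^{\pm}$ are differentiable on $\mathbb{R}^2$, and the following identities hold at every point of $\mathbb{R}^2$ (in particular on the unit disk): $$\operatorname{curl}\mathbf{n}_{mj}^{+}=0\qquad (m\in\mathbb{Z},\ j\ge 1),$$ $$\operatorname{curl}\mathbf{n}_{0j}^{-}=-4j\,z_{0j}\qquad (j\ge 1),$$ $$\operatorname{curl}\mathbf{n}_{mj}^{-}=-\frac{4(2j+|m|)(2j+|m|+1)(2j+|m|+2)}{\mathfrak{r}_j^{(|m|-1)}}\;i\,\mathrm{sign}(m)\,z_{mj}\qquad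 (m\ne 0,\ j\ge 0).$$ -/

import Mathlib

noncomputable section

namespace DiskVectorOP

open Matrix

/-- The Jacobi polynomial `P_n^{(α,β)}`, given by its expansion about `1`:
`∑ₗ (n+α+β+1)ₗ (α+l+1)ₙ₋ₗ / (l! (n-l)!) ((x-1)/2)^l`, with `(c)ₖ` the rising factorial. -/
def jacobiP (n : ℕ) (α β : ℝ) : Polynomial ℝ :=
  ∑ l ∈ Finset.range (n + 1),
    Polynomial.C
        ((ascPochhammer ℝ l).eval (n + α + β + 1) * (ascPochhammer ℝ (n - l)).eval (α + l + 1)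
          / (l.factorial * (n - l).factorial)) *
      (Polynomial.C (1 / 2) * (Polynomial.X - 1)) ^ l

/-- The polar radius `r` of the point `p = (x, y)`. -/
def radius (p : ℝ × ℝ) : ℝ := √(p.1 ^ 2 + p.2 ^ 2)

/-- The polar angle `θ` of the point `p = (x, y)` (with value `0` at the origin). -/
def angle (p : ℝ × ℝ) : ℝ := Complex.arg ⟨p.1, p.2⟩

/-- The rotation matrix `ρ(φ)`. -/
def rot (φ : ℝ) : Matrix (Fin 2) (Fin 2) ℂ :=
  !![(Real.cos φ : ℂ), -(Real.sin φ : ℂ); (Real.sin φ : ℂ), (Real.cos φ : ℂ)]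

/-- The harmonic polynomial `y_m(x, y) = (x + i sign(m) y)^{|m|} = r^{|m|} e^{imθ}`. -/
def harmonicY (m : ℤ) (p : ℝ × ℝ) : ℂ :=
  ((p.1 : ℂ) + (m.sign : ℂ) * Complex.I * (p.2 : ℂ)) ^ m.natAbs

/-- The generalised Zernike polynomial `z_{mj}^{(lam)} = P_j^{(lam,|m|)}(2r² - 1) y_m`. -/
def zernikeGen (lam : ℝ) (m : ℤ) (j : ℕ) (p : ℝ × ℝ) : ℂ :=
  (((jacobiP j lam (m.natAbs : ℝ)).eval (2 * radius p ^ 2 - 1) : ℝ) : ℂ) * harmonicY m p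

/-- The standard Zernike polynomial `z_{mj}`. -/
def zernike (m : ℤ) (j : ℕ) (p : ℝ × ℝ) : ℂ := zernikeGen 0 m j p

/-- The constant `𝔯_n^{(b)}`. -/
def frakR (n : ℕ) (b : ℝ) : ℝ :=
  10 * (n : ℝ) ^ 2 + n * (13 * b + 19) + 4 * (b + 1) * (b + 2)

/-- The univariate vector polynomial `𝐯_n^{(b)}(t)`. -/
def vecV (n : ℕ) (b t : ℝ) : Fin 2 → ℝ :=
  ![(b + 1) * (1 - t) * (jacobiP n 1 (b + 1)).eval (2 * t - 1)
      - 2 * t * (n + 1) * (jacobiP n 0 (b + 2)).eval (2 * t - 1),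
    (b + 1) * (jacobiP n 1 (b + 1)).eval (2 * t - 1)]

/-- The univariate vector polynomial `𝐪_n^{(b),1}(t)`. -/
def vecQ1 (n : ℕ) (b t : ℝ) : Fin 2 → ℝ :=
  ((2 * n + b + 1) / ((n + 1) * frakR n b)) •
    (((2 * n + b + 2) * (2 * n + b + 3) * (jacobiP n 1 b).eval (2 * t - 1)) • ![1 - t, 1]
      - (n + b + 2) • vecV n b t)

/-- The univariate vector polynomial `𝐪_n^{(b),2}(t) = -𝐯_{n-1}^{(b)}(t)/n - 𝐪_n^{(b),1}(t)` for
`n ≥ 1`, with the convention `𝐪_0^{(b),2} = 0`. -/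
def vecQ2 : ℕ → ℝ → ℝ → Fin 2 → ℝ
  | 0, _, _ => 0
  | n + 1, b, t => -((1 / ((n : ℝ) + 1)) • vecV n b t) - vecQ1 (n + 1) b t

/-- For `m ≠ 0`, the map `𝒫_m` from univariate vector polynomials to vector fields of mode `m`:
`𝒫_m 𝐟 = r^{|m|-1} e^{imθ} ρ(θ) diag(1, i sign m) 𝐟(r²)`. -/
def modeMap (m : ℤ) (f : ℝ → Fin 2 → ℝ) (p : ℝ × ℝ) : Fin 2 → ℂ :=
  ((radius p : ℂ) ^ (m.natAbs - 1) * Complex.exp (Complex.I * m * angle p)) •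
    (rot (angle p) *ᵥ
      (Matrix.diagonal ![1, Complex.I * (m.sign : ℂ)] *ᵥ fun k => ((f (radius p ^ 2) k : ℝ) : ℂ)))

/-- The matrix weight `N(x, y)`, normal at the boundary of the unit disk. -/
def weightN (p : ℝ × ℝ) : Matrix (Fin 2) (Fin 2) ℂ :=
  !![1 - (p.2 : ℂ) ^ 2, (p.1 : ℂ) * (p.2 : ℂ); (p.1 : ℂ) * (p.2 : ℂ), 1 - (p.1 : ℂ) ^ 2]

/-- `𝐯_{mj}^{N,1}`: for `m = 0`, `j ≥ 1` it is `P_{j-1}^{(0,1)}(2r² - 1) r 𝐞_r`, where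
`r 𝐞_r = (x, y)`; for `m ≠ 0` it is `𝒫_m 𝐪_j^{(|m|-1),1}`. The case `m = j = 0` is unused. -/
def vecN1 (m : ℤ) (j : ℕ) (p : ℝ × ℝ) : Fin 2 → ℂ :=
  if m = 0 then
    (((jacobiP (j - 1) 0 1).eval (2 * radius p ^ 2 - 1) : ℝ) : ℂ) • ![(p.1 : ℂ), (p.2 : ℂ)]
  else modeMap m (vecQ1 j ((m.natAbs : ℝ) - 1)) p

/-- `𝐯_{mj}^{N,2}`: for `m = 0`, `j ≥ 1` it is `P_{j-1}^{(1,1)}(2r² - 1) r 𝐞_θ`, where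
`r 𝐞_θ = (-y, x)`; for `m ≠ 0` it is `𝒫_m 𝐪_j^{(|m|-1),2}`. The case `m = j = 0` is unused. -/
def vecN2 (m : ℤ) (j : ℕ) (p : ℝ × ℝ) : Fin 2 → ℂ :=
  if m = 0 then
    (((jacobiP (j - 1) 1 1).eval (2 * radius p ^ 2 - 1) : ℝ) : ℂ) • ![-(p.2 : ℂ), (p.1 : ℂ)]
  else modeMap m (vecQ2 j ((m.natAbs : ℝ) - 1)) p

/-- `𝐧_{mj}^1 = N 𝐯_{mj}^{N,1}`. -/
def n1 (m : ℤ) (j : ℕ) (p : ℝ × ℝ) : Fin 2 → ℂ := weightN p *ᵥ vecN1 m j p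

/-- `𝐧_{mj}^2 = N 𝐯_{mj}^{N,2}`. -/
def n2 (m : ℤ) (j : ℕ) (p : ℝ × ℝ) : Fin 2 → ℂ := weightN p *ᵥ vecN2 m j p

/-- `𝐧_{mj}^+`, meaningful for `j ≥ 1`. -/
def nPlus (m : ℤ) (j : ℕ) (p : ℝ × ℝ) : Fin 2 → ℂ :=
  if m = 0 then (2 : ℂ) • n1 0 j p else n1 m j p + n2 m j p

/-- `𝐧_{mj}^-`, meaningful for `m ≠ 0` or `j ≥ 1`. -/
def nMinus (m : ℤ) (j : ℕ) (p : ℝ × ℝ) : Fin 2 → ℂ :=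
  if m = 0 then (2 : ℂ) • n2 0 j p
  else if j = 0 then (2 : ℂ) • n1 m 0 p
  else n1 m j p - n2 m j p

/-- The planar curl `∂_x f₂ - ∂_y f₁` of a vector field `f = (f₁, f₂)`. -/
def curl (f : ℝ × ℝ → Fin 2 → ℂ) (p : ℝ × ℝ) : ℂ :=
  deriv (fun x : ℝ => f (x, p.2) 1) p.1 - deriv (fun y : ℝ => f (p.1, y) 0) p.2

end DiskVectorOP

end

noncomputable section

namespace DiskVectorOP

open Matrix Polynomial

/-! For `m ≠ 0` put `b = |m| - 1`, `c = i sign(m)`, `w = x + c y`. After multiplication by `N`, a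
mode-`m` field with profile `(A + tG, A)` is polynomial in `x, y` (`weightN_mulVec_modeMap`). Since
`c² = -1`, its curl is `c w^|m|` times a univariate symbol at `r²`: `2((1-t)A)' - (b+1)(A+G)`
(`curl_polyField`).

The symbol is evaluated through `((1-t)P_n^{(1,β)})' = -(n+1)P_n^{(0,β+1)}`, with argument `2t - 1`.
It vanishes on `𝐯_n` and sends `P_n^{(1,b)}(1-t, 1)` to a multiple of `P_n^{(0,|m|)}`, the Zernike
radial factor. The plus fields involve only `𝐯_{j-1}`; the minus fields are `2𝐪_j^1` up to such a
term.

For `m = 0` the plus field is radial, and the azimuthal one reduces to `(t(1-t)P_n^{(1,1)})' =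
-(n+1)P_{n+1}^{(0,0)}`. -/

/-! ### Derivative formulas for shifted Jacobi polynomials -/

/-- The coefficient of `((x - 1) / 2) ^ l` in the Jacobi polynomial `P_n^{(α,β)}`. -/
def jacobiCoeff (n : ℕ) (α β : ℝ) (l : ℕ) : ℝ :=
  (ascPochhammer ℝ l).eval (n + α + β + 1) * (ascPochhammer ℝ (n - l)).eval (α + l + 1)
    / (l.factorial * (n - l).factorial)

/-- The Jacobi polynomial shifted to `[0, 1]`, that is `P_n^{(α,β)}(2t - 1)`. -/
def shiftedJacobi (n : ℕ) (α β : ℝ) : ℝ[X] :=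
  ∑ l ∈ Finset.range (n + 1), C (jacobiCoeff n α β l) * (X - 1) ^ l

lemma eval_shiftedJacobi (n : ℕ) (α β t : ℝ) :
    (shiftedJacobi n α β).eval t = (jacobiP n α β).eval (2 * t - 1) := by
  simp only [shiftedJacobi, jacobiP, jacobiCoeff, eval_finsetSum, eval_mul, eval_C, eval_pow,
    eval_sub, eval_X, eval_one]
  refine Finset.sum_congr rfl fun l _ => ?_
  congr 2
  ring

/-- The first rising factorial sees only `α + β`, so moving a unit from `α` to `β` leaves it alone.
The second changes by `x (x+1)_d = (x)_d (x+d)` at `x = l + 1`. -/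
lemma jacobiCoeff_one (n : ℕ) (β : ℝ) {l : ℕ} (hl : l ≤ n) :
    (l + 1 : ℝ) * jacobiCoeff n 1 β l = (n + 1) * jacobiCoeff n 0 (β + 1) l := by
  obtain ⟨d, rfl⟩ := Nat.exists_eq_add_of_le hl
  have h : ∀ x : ℝ, x * (ascPochhammer ℝ d).eval (x + 1)
      = (ascPochhammer ℝ d).eval x * (x + d) := by
    intro x
    have h1 := congrArg (Polynomial.eval x) (ascPochhammer_succ_left ℝ d)
    have h2 := congrArg (Polynomial.eval x) (ascPochhammer_succ_right ℝ d)
    rw [h1] at h2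
    simpa [eval_comp] using h2
  have h := h (l + 1)
  simp only [jacobiCoeff, Nat.add_sub_cancel_left]
  push_cast
  rw [show (1 + l + 1 : ℝ) = l + 1 + 1 by ring, show (0 + l + 1 : ℝ) = l + 1 by ring,
    show (l + d + 1 + β + 1 : ℝ) = l + d + 0 + (β + 1) + 1 by ring]
  linear_combination ((ascPochhammer ℝ l).eval (l + d + 0 + (β + 1) + 1 : ℝ)
    / (l.factorial * d.factorial)) * h

lemma derivative_X_sub_one_pow (k : ℕ) :
    derivative ((X - 1 : ℝ[X]) ^ (k + 1)) = (k + 1 : ℝ[X]) * (X - 1) ^ k := by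
  simpa using derivative_X_sub_C_pow (1 : ℝ) (k + 1)

lemma derivative_one_sub_X_mul_shiftedJacobi (n : ℕ) (β : ℝ) :
    derivative ((1 - X) * shiftedJacobi n 1 β)
      = -(C (n + 1 : ℝ) * shiftedJacobi n 0 (β + 1)) := by
  simp only [shiftedJacobi, Finset.mul_sum, derivative_sum, ← Finset.sum_neg_distrib]
  refine Finset.sum_congr rfl fun l hl => ?_
  have h := congrArg (C : ℝ → ℝ[X])
    (jacobiCoeff_one n β (Nat.lt_succ_iff.1 (Finset.mem_range.1 hl)))
  simp only [map_mul, map_add, map_one, map_natCast] at h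
  rw [show (1 - X : ℝ[X]) * (C (jacobiCoeff n 1 β l) * (X - 1) ^ l)
    = -(C (jacobiCoeff n 1 β l) * (X - 1) ^ (l + 1)) by ring]
  simp only [derivative_neg, derivative_C_mul, derivative_X_sub_one_pow, map_add, map_one,
    map_natCast]
  linear_combination (-(X - 1) ^ l) * h

lemma ascPochhammer_eval_natCast_add_one (a k : ℕ) :
    (ascPochhammer ℝ k).eval (a + 1 : ℝ) = (a + k).factorial / a.factorial := by
  rw [eq_div_iff (by positivity), mul_comm, ← Nat.factorial_mul_ascFactorial a k]
  push_cast
  rw [← ascPochhammer_nat_eq_ascFactorial, ascPochhammer_eval_cast]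
  push_cast
  rfl

lemma jacobiCoeff_one_one (l d : ℕ) :
    jacobiCoeff (l + d) 1 1 l
      = (2 * l + d + 2).factorial
        / ((l + d + 2) * ((l + 1).factorial * l.factorial * d.factorial)) := by
  have h1 := ascPochhammer_eval_natCast_add_one (l + d + 2) l
  have h2 := ascPochhammer_eval_natCast_add_one (l + 1) d
  push_cast at h1 h2
  rw [jacobiCoeff, Nat.add_sub_cancel_left]
  push_cast
  rw [show (l + d + 1 + 1 + 1 : ℝ) = l + d + 2 + 1 by ring,
    show (1 + l + 1 : ℝ) = l + 1 + 1 by ring, h1, h2,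
    show l + d + 2 + l = 2 * l + d + 2 by ring, show l + 1 + d = l + d + 1 by ring,
    show (l + d + 2).factorial = (l + d + 2) * (l + d + 1).factorial from Nat.factorial_succ _]
  push_cast
  field_simp

lemma jacobiCoeff_zero_zero (l d : ℕ) :
    jacobiCoeff (l + d) 0 0 l
      = (2 * l + d).factorial / (l.factorial * l.factorial * d.factorial) := by
  have h1 := ascPochhammer_eval_natCast_add_one (l + d) l
  have h2 := ascPochhammer_eval_natCast_add_one l d
  push_cast at h1 h2
  rw [jacobiCoeff, Nat.add_sub_cancel_left]
  push_cast
  rw [add_zero, add_zero, zero_add, h1, h2, show l + d + l = 2 * l + d by ring]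
  field_simp

/-- This and the next two lemmas compare coefficients of powers of `X - 1` in the derivative of
`X(1-X)P_n^{(1,1)}`. Writing `X = (X-1) + 1` mixes neighbouring coefficients, so the lowest and
highest powers are separate cases. -/
lemma jacobiCoeff_one_one_zero (n : ℕ) :
    jacobiCoeff n 1 1 0 = (n + 1) * jacobiCoeff (n + 1) 0 0 0 := by
  have h1 := jacobiCoeff_one_one 0 n
  have h2 := jacobiCoeff_zero_zero 0 (n + 1)
  simp only [zero_add, mul_zero, Nat.cast_zero] at h1 h2
  rw [h1, h2, Nat.factorial_succ, Nat.factorial_succ]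
  push_cast
  simp only [Nat.factorial]
  field_simp
  ring

lemma jacobiCoeff_one_one_last (n : ℕ) :
    (n + 2 : ℝ) * jacobiCoeff n 1 1 n = (n + 1) * jacobiCoeff (n + 1) 0 0 (n + 1) := by
  have h1 := jacobiCoeff_one_one n 0
  have h2 := jacobiCoeff_zero_zero (n + 1) 0
  simp only [add_zero, Nat.cast_zero] at h1 h2
  rw [h1, h2, show 2 * (n + 1) = 2 * n + 2 by ring, Nat.factorial_succ n]
  push_cast
  field_simp

lemma jacobiCoeff_one_one_succ {n l : ℕ} (hl : l < n) :
    (l + 2 : ℝ) * (jacobiCoeff n 1 1 (l + 1) + jacobiCoeff n 1 1 l)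
      = (n + 1) * jacobiCoeff (n + 1) 0 0 (l + 1) := by
  obtain ⟨d, rfl⟩ := Nat.exists_eq_add_of_lt hl
  have h1 := jacobiCoeff_one_one (l + 1) d
  have h2 := jacobiCoeff_one_one l (d + 1)
  have h3 := jacobiCoeff_zero_zero (l + 1) (d + 1)
  rw [show l + 1 + d = l + d + 1 by ring, show 2 * (l + 1) + d + 2 = 2 * l + d + 3 + 1 by ring,
    Nat.factorial_succ (2 * l + d + 3), Nat.factorial_succ (l + 1), Nat.factorial_succ l] at h1
  rw [show l + (d + 1) = l + d + 1 by ring, show 2 * l + (d + 1) + 2 = 2 * l + d + 3 by ring,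
    Nat.factorial_succ l, Nat.factorial_succ d] at h2
  rw [show l + 1 + (d + 1) = l + d + 1 + 1 by ring,
    show 2 * (l + 1) + (d + 1) = 2 * l + d + 3 by ring, Nat.factorial_succ l,
    Nat.factorial_succ d] at h3
  rw [h1, h2, h3]
  push_cast
  field_simp
  ring

lemma derivative_X_mul_one_sub_X_mul_shiftedJacobi (n : ℕ) :
    derivative (X * ((1 - X) * shiftedJacobi n 1 1))
      = -(C (n + 1 : ℝ) * shiftedJacobi (n + 1) 0 0) := by
  have key : derivative (X * ((1 - X) * shiftedJacobi n 1 1))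
      = -((∑ l ∈ Finset.range (n + 1), C ((l + 1 : ℝ) * jacobiCoeff n 1 1 l) * (X - 1) ^ l)
        + ∑ l ∈ Finset.range (n + 1), C ((l + 2 : ℝ) * jacobiCoeff n 1 1 l)
          * (X - 1) ^ (l + 1)) := by
    simp only [shiftedJacobi, Finset.mul_sum, derivative_sum, ← Finset.sum_add_distrib,
      ← Finset.sum_neg_distrib]
    refine Finset.sum_congr rfl fun l _ => ?_
    rw [show (X * ((1 - X) * (C (jacobiCoeff n 1 1 l) * (X - 1) ^ l)) : ℝ[X])
      = -(C (jacobiCoeff n 1 1 l) * ((X - 1) ^ (l + 1) + (X - 1) ^ (l + 1 + 1))) by ring]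
    simp only [derivative_neg, derivative_C_mul, derivative_X_sub_one_pow,
      map_add, map_mul, map_one, map_natCast, map_ofNat]
    push_cast
    ring
  -- Peel off the powers `0` and `n + 1`, each met by only one of the two sums; the remaining ranges
  -- then align.
  rw [key, shiftedJacobi, Finset.sum_range_succ', Finset.sum_range_succ _ n,
    Finset.sum_range_succ' _ (n + 1), Finset.sum_range_succ _ n]
  have h0 := congrArg (C : ℝ → ℝ[X]) (jacobiCoeff_one_one_zero n)
  have h1 := congrArg (C : ℝ → ℝ[X]) (jacobiCoeff_one_one_last n)
  have hs : (∑ l ∈ Finset.range n,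
        C (((l + 1 : ℕ) + 1 : ℝ) * jacobiCoeff n 1 1 (l + 1)) * (X - 1 : ℝ[X]) ^ (l + 1))
      + ∑ l ∈ Finset.range n, C ((l + 2 : ℝ) * jacobiCoeff n 1 1 l) * (X - 1) ^ (l + 1)
      = C (n + 1 : ℝ) * ∑ l ∈ Finset.range n,
          C (jacobiCoeff (n + 1) 0 0 (l + 1)) * (X - 1) ^ (l + 1) := by
    rw [Finset.mul_sum, ← Finset.sum_add_distrib]
    refine Finset.sum_congr rfl fun l hl => ?_
    have h := congrArg (C : ℝ → ℝ[X]) (jacobiCoeff_one_one_succ (Finset.mem_range.1 hl))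
    rw [← mul_assoc, ← C_mul, ← h, ← add_mul, ← C_add]
    congr 2
    push_cast
    ring
  rw [C_mul] at h0 h1
  simp only [Nat.cast_zero, zero_add, one_mul, pow_zero, mul_one]
  rw [C_mul] at h1 ⊢
  linear_combination -hs - h0 - (X - 1) ^ (n + 1) * h1

/-! ### The curl of a mode-`m` field in Cartesian form -/

/-- The vector field `w^b (1, c) A + w^{b+1} (x, y) G - c w^{b+1} (-y, x) A`, where `w = x + c y` and
`A`, `G` are evaluated at `r²`. -/
def polyField (c : ℂ) (b : ℕ) (A G : ℝ[X]) (p : ℝ × ℝ) : Fin 2 → ℂ :=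
  ![((p.1 : ℂ) + c * p.2) ^ b * (A.eval (p.1 ^ 2 + p.2 ^ 2) : ℝ)
      + ((p.1 : ℂ) + c * p.2) ^ (b + 1)
        * (p.1 * (G.eval (p.1 ^ 2 + p.2 ^ 2) : ℝ) + c * p.2 * (A.eval (p.1 ^ 2 + p.2 ^ 2) : ℝ)),
    ((p.1 : ℂ) + c * p.2) ^ b * (c * (A.eval (p.1 ^ 2 + p.2 ^ 2) : ℝ))
      + ((p.1 : ℂ) + c * p.2) ^ (b + 1)
        * (p.2 * (G.eval (p.1 ^ 2 + p.2 ^ 2) : ℝ) - c * p.1 * (A.eval (p.1 ^ 2 + p.2 ^ 2) : ℝ))]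

lemma differentiable_ofReal_eval (A : ℝ[X]) :
    Differentiable ℝ fun p : ℝ × ℝ => ((A.eval (p.1 ^ 2 + p.2 ^ 2) : ℝ) : ℂ) := by
  have h : Differentiable ℝ fun p : ℝ × ℝ => A.eval (p.1 ^ 2 + p.2 ^ 2) :=
    A.differentiable.comp (by fun_prop)
  exact Complex.ofRealCLM.differentiable.comp h

lemma differentiable_ofReal_fst : Differentiable ℝ fun p : ℝ × ℝ => (p.1 : ℂ) :=
  Complex.ofRealCLM.differentiable.comp differentiable_fst

lemma differentiable_ofReal_snd : Differentiable ℝ fun p : ℝ × ℝ => (p.2 : ℂ) :=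
  Complex.ofRealCLM.differentiable.comp differentiable_snd

lemma differentiable_polyField (c : ℂ) (b : ℕ) (A G : ℝ[X]) :
    Differentiable ℝ (polyField c b A G) := by
  have hA := differentiable_ofReal_eval A
  have hG := differentiable_ofReal_eval G
  have hx := differentiable_ofReal_fst
  have hy := differentiable_ofReal_snd
  rw [differentiable_pi]
  intro i
  fin_cases i <;> simp only [polyField] <;> simp <;> fun_prop

lemma hasDerivAt_ofReal_eval_left (A : ℝ[X]) (x y : ℝ) :
    HasDerivAt (fun x : ℝ => ((A.eval (x ^ 2 + y ^ 2) : ℝ) : ℂ))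
      ((A.derivative.eval (x ^ 2 + y ^ 2) : ℝ) * (2 * x)) x := by
  have h := (A.hasDerivAt (x ^ 2 + y ^ 2)).comp x (((hasDerivAt_id x).pow 2).add_const (y ^ 2))
  have h := h.ofReal_comp
  simpa using h

lemma hasDerivAt_ofReal_eval_right (A : ℝ[X]) (x y : ℝ) :
    HasDerivAt (fun y : ℝ => ((A.eval (x ^ 2 + y ^ 2) : ℝ) : ℂ))
      ((A.derivative.eval (x ^ 2 + y ^ 2) : ℝ) * (2 * y)) y := by
  simpa only [add_comm] using hasDerivAt_ofReal_eval_left A y x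

/-- Both `c x - y = c w` and `y - c x = -c w` follow from `c² = -1`, and they restore the factor
`w`. The `G'` terms cancel because `r²` is radial. -/
lemma curl_polyField {c : ℂ} (hc : c ^ 2 = -1) (b : ℕ) (A G : ℝ[X]) (p : ℝ × ℝ) :
    curl (polyField c b A G) p
      = c * ((p.1 : ℂ) + c * p.2) ^ (b + 1)
        * ((2 * (derivative ((1 - X) * A)) - C (b + 1 : ℝ) * (A + G)).eval
            (p.1 ^ 2 + p.2 ^ 2) : ℝ) := by
  obtain ⟨x, y⟩ := p
  have hx : HasDerivAt (fun x : ℝ => (x : ℂ)) 1 x := (hasDerivAt_id x).ofReal_comp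
  have hy : HasDerivAt (fun y : ℝ => (y : ℂ)) 1 y := (hasDerivAt_id y).ofReal_comp
  have hwx : HasDerivAt (fun x : ℝ => (x : ℂ) + c * y) 1 x := hx.add_const _
  have hwy : HasDerivAt (fun y : ℝ => (x : ℂ) + c * y) (c * 1) y := (hy.const_mul c).const_add _
  have hAx := hasDerivAt_ofReal_eval_left A x y
  have hGx := hasDerivAt_ofReal_eval_left G x y
  have hAy := hasDerivAt_ofReal_eval_right A x y
  have hGy := hasDerivAt_ofReal_eval_right G x y
  have h1 := ((hwx.fun_pow b).fun_mul (hAx.const_mul c)).fun_add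
    ((hwx.fun_pow (b + 1)).fun_mul ((hGx.const_mul (y : ℂ)).fun_sub ((hx.const_mul c).fun_mul hAx)))
  have h2 := ((hwy.fun_pow b).fun_mul hAy).fun_add
    ((hwy.fun_pow (b + 1)).fun_mul ((hGy.const_mul (x : ℂ)).fun_add ((hy.const_mul c).fun_mul hAy)))
  have e1 := h1.deriv
  have e2 := h2.deriv
  simp only [curl, polyField, cons_val_zero, cons_val_one]
  rw [e1, e2]
  simp only [eval_sub, eval_mul, eval_add, eval_C, eval_X, eval_one, derivative_mul,
    derivative_sub, derivative_one, derivative_X, eval_ofNat, eval_zero, Nat.add_sub_cancel]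
  push_cast
  generalize ((A.eval (x ^ 2 + y ^ 2) : ℝ) : ℂ) = a
  generalize ((G.eval (x ^ 2 + y ^ 2) : ℝ) : ℂ) = g
  generalize ((A.derivative.eval (x ^ 2 + y ^ 2) : ℝ) : ℂ) = a'
  generalize ((G.derivative.eval (x ^ 2 + y ^ 2) : ℝ) : ℂ) = g'
  -- The terms in `w^(b-1)` are equal in the two partial derivatives and cancel, so `b = 0` is not
  -- special.
  rw [pow_succ]
  generalize (x + c * y : ℂ) ^ b = w
  linear_combination (w * y * ((b + 1) * g - 2 * a')) * hc

/-! ### From polar to Cartesian coordinates -/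

lemma radius_sq (p : ℝ × ℝ) : radius p ^ 2 = p.1 ^ 2 + p.2 ^ 2 :=
  Real.sq_sqrt (by positivity)

lemma radius_eq_norm (p : ℝ × ℝ) : radius p = ‖(⟨p.1, p.2⟩ : ℂ)‖ := by
  rw [radius, Complex.norm_def, Complex.normSq_mk]
  congr 1
  ring

lemma radius_mul_cos_angle (p : ℝ × ℝ) : radius p * Real.cos (angle p) = p.1 := by
  rw [radius_eq_norm, angle, Complex.norm_mul_cos_arg]

lemma radius_mul_sin_angle (p : ℝ × ℝ) : radius p * Real.sin (angle p) = p.2 := by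
  rw [radius_eq_norm, angle, Complex.norm_mul_sin_arg]

lemma exp_I_mul_int_mul {m : ℤ} (hm : m ≠ 0) (φ : ℝ) :
    Complex.exp (Complex.I * m * φ)
      = ((Real.cos φ : ℂ) + Complex.I * (m.sign : ℂ) * Real.sin φ) ^ m.natAbs := by
  have h : (Complex.I * m * φ : ℂ) = (m.natAbs : ℕ) * ((m.sign * φ : ℂ) * Complex.I) := by
    have h := congrArg (Int.cast : ℤ → ℂ) (Int.sign_mul_natAbs m)
    push_cast at h
    rw [← h]
    simp
    ring
  rw [h, Complex.exp_nat_mul, Complex.exp_mul_I]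
  congr 1
  rcases lt_or_gt_of_ne hm with h | h
  · simp [Int.sign_eq_neg_one_of_neg h, mul_comm]
  · simp [Int.sign_eq_one_of_pos h, mul_comm]

lemma I_mul_sign_sq {m : ℤ} (hm : m ≠ 0) : (Complex.I * (m.sign : ℂ)) ^ 2 = -1 := by
  rcases lt_or_gt_of_ne hm with h | h
  · simp [Int.sign_eq_neg_one_of_neg h]
  · simp [Int.sign_eq_one_of_pos h]

lemma harmonicY_eq (m : ℤ) (p : ℝ × ℝ) :
    harmonicY m p = ((p.1 : ℂ) + Complex.I * (m.sign : ℂ) * p.2) ^ m.natAbs := by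
  rw [harmonicY, mul_comm Complex.I]

/-- If `f = (A + t G, A)`, then `N 𝒫_m f` is the polynomial vector field `polyField`. -/
lemma weightN_mulVec_modeMap {m : ℤ} {b : ℕ} (hm : m.natAbs = b + 1) {f : ℝ → Fin 2 → ℝ}
    {A G : ℝ[X]} (hf : ∀ t, f t = ![(A + X * G).eval t, A.eval t]) (p : ℝ × ℝ) :
    weightN p *ᵥ modeMap m f p = polyField (Complex.I * (m.sign : ℂ)) b A G p := by
  have hm0 : m ≠ 0 := by rintro rfl; simp at hm
  have hc := I_mul_sign_sq hm0
  have hx := congrArg (Complex.ofReal) (radius_mul_cos_angle p)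
  have hy := congrArg (Complex.ofReal) (radius_mul_sin_angle p)
  have h1 := congrArg (Complex.ofReal) (Real.cos_sq_add_sin_sq (angle p))
  push_cast at hx hy h1
  simp only [modeMap, polyField, weightN, rot, hf, exp_I_mul_int_mul hm0, hm, Nat.add_sub_cancel,
    radius_sq, eval_add, eval_mul, eval_X]
  generalize (Complex.I * (m.sign : ℂ)) = c at *
  generalize A.eval (p.1 ^ 2 + p.2 ^ 2) = a
  generalize G.eval (p.1 ^ 2 + p.2 ^ 2) = g
  ext i
  fin_cases i <;> simp [Matrix.mulVec, dotProduct, Fin.sum_univ_two]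
  all_goals
    -- With `x = r u`, `y = r v`, only `u² + v² = 1` and `c² = -1` are needed. Nothing is divided by
    -- `r`, so the origin is covered.
    rw [← hx, ← hy]
    generalize (radius p : ℂ) = r at *
    generalize Complex.cos (angle p : ℂ) = u at *
    generalize Complex.sin (angle p : ℂ) = v at *
    rw [show r * u + c * (r * v) = r * (u + c * v) by ring]
    simp only [mul_pow, pow_succ _ b]
    generalize (u + c * v) ^ b = e
    generalize r ^ b = q
  · linear_combination (q * e * ((u + c * v) * r ^ 2 * (u * g + v * c * a) + a)) * h1
      - (q * e * v ^ 2 * a) * hc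
  · linear_combination (q * e * ((u + c * v) * r ^ 2 * (v * g - u * c * a) + a * c)) * h1
      + (q * e * a * u * v) * hc

/-! ### Curl symbols of the univariate vector polynomials -/

/-- The polynomial `s` for which `curl (N 𝒫_m f) = i sign(m) y_m s(r²)`, where `|m| = b + 1` and
`f = (A + t G, A)`. -/
def curlSymbol (b : ℕ) (A G : ℝ[X]) : ℝ[X] :=
  2 * derivative ((1 - X) * A) - C (b + 1 : ℝ) * (A + G)

lemma curl_weightN_modeMap {m : ℤ} {b : ℕ} (hm : m.natAbs = b + 1) {f : ℝ → Fin 2 → ℝ}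
    {A G : ℝ[X]} (hf : ∀ t, f t = ![(A + X * G).eval t, A.eval t]) :
    Differentiable ℝ (fun p => weightN p *ᵥ modeMap m f p) ∧
      ∀ p, curl (fun p => weightN p *ᵥ modeMap m f p) p
        = Complex.I * (m.sign : ℂ) * harmonicY m p
          * ((curlSymbol b A G).eval (radius p ^ 2) : ℝ) := by
  rw [show (fun p => weightN p *ᵥ modeMap m f p) = polyField (Complex.I * (m.sign : ℂ)) b A G from
    funext (weightN_mulVec_modeMap hm hf)]
  refine ⟨differentiable_polyField _ _ _ _, fun p => ?_⟩
  rw [curl_polyField (I_mul_sign_sq (by rintro rfl; simp at hm)), harmonicY_eq, hm, radius_sq,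
    curlSymbol]

/-- The second component of `𝐯_n^{(b)}` as a polynomial. -/
def polyV (n b : ℕ) : ℝ[X] := C (b + 1 : ℝ) * shiftedJacobi n 1 (b + 1)

/-- The difference of the components of `𝐯_n^{(b)}`, divided by `t`. -/
def polyVDiff (n b : ℕ) : ℝ[X] :=
  -(C (b + 1 : ℝ) * shiftedJacobi n 1 (b + 1)) - C (2 * (n + 1 : ℝ)) * shiftedJacobi n 0 (b + 2)

lemma vecV_eq (n b : ℕ) (t : ℝ) :
    vecV n b t = ![(polyV n b + X * polyVDiff n b).eval t, (polyV n b).eval t] := by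
  simp only [vecV, polyV, polyVDiff, eval_add, eval_sub, eval_neg, eval_mul, eval_X, eval_C,
    eval_shiftedJacobi]
  congr 1
  ring

/-- Here `A + G = -2(n+1)P_n^{(0,b+2)}`, which exactly balances the derivative formula at `β = b +
1`. -/
lemma curlSymbol_polyV (n b : ℕ) : curlSymbol b (polyV n b) (polyVDiff n b) = 0 := by
  have h := derivative_one_sub_X_mul_shiftedJacobi n (b + 1)
  rw [show (b + 1 + 1 : ℝ) = b + 2 by ring] at h
  simp only [curlSymbol, polyV, polyVDiff]
  rw [mul_left_comm, derivative_C_mul, h]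
  simp only [map_mul, map_ofNat]
  ring

/-- The profile `P(1-t, 1)` has `G = -A`, so only the derivative term survives. -/
lemma curlSymbol_shiftedJacobi (n b : ℕ) :
    curlSymbol b (shiftedJacobi n 1 b) (-shiftedJacobi n 1 b)
      = C (-(2 * (n + 1 : ℝ))) * shiftedJacobi n 0 (b + 1) := by
  rw [curlSymbol, derivative_one_sub_X_mul_shiftedJacobi]
  simp only [map_neg, map_mul, map_ofNat]
  ring

lemma curlSymbol_combination (b : ℕ) (x y : ℝ) (A G A' G' : ℝ[X]) :
    curlSymbol b (C x * A + C y * A') (C x * G + C y * G')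
      = C x * curlSymbol b A G + C y * curlSymbol b A' G' := by
  simp only [curlSymbol]
  rw [mul_add, mul_left_comm, mul_left_comm _ (C y), derivative_add, derivative_C_mul,
    derivative_C_mul]
  ring

/-- The coefficient of `P_n^{(1,b)}(2t - 1) (1 - t, 1)` in `𝐪_n^{(b),1}(t)`. -/
def coeffQ (n b : ℕ) : ℝ :=
  (2 * n + b + 1) / ((n + 1) * frakR n b) * ((2 * n + b + 2) * (2 * n + b + 3))

lemma modeMap_add (m : ℤ) (f g : ℝ → Fin 2 → ℝ) (p : ℝ × ℝ) :
    modeMap m f p + modeMap m g p = modeMap m (f + g) p := by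
  simp only [modeMap, ← smul_add, ← Matrix.mulVec_add]
  congr 3
  ext k
  simp

lemma modeMap_sub (m : ℤ) (f g : ℝ → Fin 2 → ℝ) (p : ℝ × ℝ) :
    modeMap m f p - modeMap m g p = modeMap m (f - g) p := by
  simp only [modeMap, ← smul_sub, ← Matrix.mulVec_sub]
  congr 3
  ext k
  simp

lemma vecQ1_eq (n b : ℕ) (t : ℝ) :
    vecQ1 n b t = (coeffQ n b * (shiftedJacobi n 1 b).eval t) • ![1 - t, 1]
      - ((2 * n + b + 1) / ((n + 1) * frakR n b) * (n + b + 2) : ℝ) • vecV n b t := by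
  rw [vecQ1, smul_sub, smul_smul, smul_smul, coeffQ, eval_shiftedJacobi]
  congr 2
  ring

lemma curl_weightN_modeMap_vecV {m : ℤ} {b : ℕ} (hm : m.natAbs = b + 1) (n : ℕ) (y : ℝ) :
    Differentiable ℝ (fun p => weightN p *ᵥ modeMap m (fun t => y • vecV n b t) p) ∧
      ∀ p, curl (fun p => weightN p *ᵥ modeMap m (fun t => y • vecV n b t) p) p = 0 := by
  have h := curl_weightN_modeMap hm (f := fun t => y • vecV n b t)
    -- The zero summands fit the two-term shape of `curlSymbol_combination`.
    (A := C y * polyV n b + C 0 * 0) (G := C y * polyVDiff n b + C 0 * 0) (fun t => by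
      rw [vecV_eq]
      ext i
      fin_cases i
      · simp
        ring
      · simp)
  refine ⟨h.1, fun p => ?_⟩
  rw [h.2 p, curlSymbol_combination, curlSymbol_polyV]
  simp

/-- The `vecV` terms have zero symbol. Leaving `l` and `y` free treats `𝐧_{mj}^-` uniformly: `y =
1/j`, `l = j - 1` for `j ≥ 1`, and `y = 0` for `j = 0`. -/
lemma curl_weightN_modeMap_vecQ1 {m : ℤ} {b : ℕ} (hm : m.natAbs = b + 1) (n l : ℕ) (y : ℝ) :
    Differentiable ℝ
        (fun p => weightN p *ᵥ modeMap m (fun t => (2 : ℝ) • vecQ1 n b t + y • vecV l b t) p) ∧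
      ∀ p, curl
          (fun p => weightN p *ᵥ modeMap m (fun t => (2 : ℝ) • vecQ1 n b t + y • vecV l b t) p) p
        = ((-(4 * (n + 1) * coeffQ n b) : ℝ) : ℂ) * Complex.I * (m.sign : ℂ) * zernike m n p := by
  set z : ℝ := (2 * n + b + 1) / ((n + 1) * frakR n b) * (n + b + 2)
  have h := curl_weightN_modeMap hm (f := fun t => (2 : ℝ) • vecQ1 n b t + y • vecV l b t)
    (A := C (2 * coeffQ n b) * shiftedJacobi n 1 b
      + C 1 * (C (-2 * z) * polyV n b + C y * polyV l b))
    (G := C (2 * coeffQ n b) * -shiftedJacobi n 1 b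
      + C 1 * (C (-2 * z) * polyVDiff n b + C y * polyVDiff l b)) (fun t => by
      rw [vecQ1_eq, vecV_eq, vecV_eq]
      ext i
      fin_cases i
      · simp [z]
        ring
      · simp [z]
        ring)
  refine ⟨h.1, fun p => ?_⟩
  rw [h.2 p, curlSymbol_combination, curlSymbol_combination, curlSymbol_polyV, curlSymbol_polyV,
    curlSymbol_shiftedJacobi, zernike, zernikeGen, hm, Nat.cast_succ, ← eval_shiftedJacobi]
  simp
  ring

/-! ### The rotationally symmetric mode `m = 0` -/

/-- A radial vector field `φ(r²) (x, y)` is differentiable and curl-free. -/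
lemma curl_radial (φ : ℝ[X]) :
    Differentiable ℝ (fun p : ℝ × ℝ =>
        (2 : ℂ) • ((φ.eval (p.1 ^ 2 + p.2 ^ 2) : ℝ) : ℂ) • ![(p.1 : ℂ), (p.2 : ℂ)]) ∧
      ∀ p, curl (fun p : ℝ × ℝ =>
        (2 : ℂ) • ((φ.eval (p.1 ^ 2 + p.2 ^ 2) : ℝ) : ℂ) • ![(p.1 : ℂ), (p.2 : ℂ)]) p = 0 := by
  constructor
  · have hφ := differentiable_ofReal_eval φ
    have hx := differentiable_ofReal_fst
    have hy := differentiable_ofReal_snd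
    rw [differentiable_pi]
    intro i
    fin_cases i <;> simp <;> fun_prop
  · rintro ⟨x, y⟩
    have h1 := ((hasDerivAt_ofReal_eval_left φ x y).mul_const (y : ℂ)).const_mul 2
    have h2 := ((hasDerivAt_ofReal_eval_right φ x y).mul_const (x : ℂ)).const_mul 2
    simp only [curl, Pi.smul_apply, cons_val_zero, cons_val_one, smul_eq_mul]
    rw [h1.deriv, h2.deriv]
    ring

lemma curl_azimuthal (φ : ℝ[X]) :
    Differentiable ℝ (fun p : ℝ × ℝ =>
        (2 : ℂ) • ((φ.eval (p.1 ^ 2 + p.2 ^ 2) : ℝ) : ℂ) • ![-(p.2 : ℂ), (p.1 : ℂ)]) ∧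
      ∀ p, curl (fun p : ℝ × ℝ =>
          (2 : ℂ) • ((φ.eval (p.1 ^ 2 + p.2 ^ 2) : ℝ) : ℂ) • ![-(p.2 : ℂ), (p.1 : ℂ)]) p
        = 4 * ((derivative (X * φ)).eval (p.1 ^ 2 + p.2 ^ 2) : ℝ) := by
  constructor
  · have hφ := differentiable_ofReal_eval φ
    have hx := differentiable_ofReal_fst
    have hy := differentiable_ofReal_snd
    rw [differentiable_pi]
    intro i
    fin_cases i <;> simp <;> fun_prop
  · rintro ⟨x, y⟩
    have hx : HasDerivAt (fun x : ℝ => (x : ℂ)) 1 x := (hasDerivAt_id x).ofReal_comp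
    have hy : HasDerivAt (fun y : ℝ => (y : ℂ)) 1 y := (hasDerivAt_id y).ofReal_comp
    have h1 := ((hasDerivAt_ofReal_eval_left φ x y).fun_mul hx).const_mul 2
    have h2 := ((hasDerivAt_ofReal_eval_right φ x y).fun_mul hy.fun_neg).const_mul 2
    simp only [curl, Pi.smul_apply, cons_val_zero, cons_val_one, smul_eq_mul]
    rw [h1.deriv, h2.deriv]
    simp only [derivative_mul, derivative_X, eval_add, eval_mul, eval_X, eval_one]
    push_cast
    ring

/-- `N` fixes the radial vector `(x, y)`. -/
lemma nPlus_zero (j : ℕ) :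
    nPlus 0 j = fun p => (2 : ℂ) • (((shiftedJacobi (j - 1) 0 1).eval (p.1 ^ 2 + p.2 ^ 2) : ℝ) : ℂ)
      • ![(p.1 : ℂ), (p.2 : ℂ)] := by
  funext p
  simp only [nPlus, n1, vecN1, if_true, ← eval_shiftedJacobi, radius_sq, Matrix.mulVec_smul]
  congr 2
  ext i
  fin_cases i <;> simp [weightN, Matrix.mulVec, dotProduct, Fin.sum_univ_two] <;> ring

/-- `(-y, x)` is an eigenvector of `N` with eigenvalue `1 - r²`. -/
lemma nMinus_zero (j : ℕ) :
    nMinus 0 j = fun p => (2 : ℂ) •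
      ((((1 - X) * shiftedJacobi (j - 1) 1 1).eval (p.1 ^ 2 + p.2 ^ 2) : ℝ) : ℂ)
        • ![-(p.2 : ℂ), (p.1 : ℂ)] := by
  funext p
  simp only [nMinus, n2, vecN2, if_true, ← eval_shiftedJacobi, radius_sq, Matrix.mulVec_smul]
  ext i
  fin_cases i <;> simp [weightN] <;> ring

/-! ### The fields for `m ≠ 0` and the final assembly -/

lemma nPlus_succ {m : ℤ} {b : ℕ} (hm : m.natAbs = b + 1) (n : ℕ) :
    nPlus m (n + 1)
      = fun p => weightN p *ᵥ modeMap m (fun t => (-(1 / (n + 1)) : ℝ) • vecV n b t) p := by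
  have hm0 : m ≠ 0 := by rintro rfl; simp at hm
  funext p
  simp only [nPlus, n1, n2, vecN1, vecN2, if_neg hm0, ← Matrix.mulVec_add, modeMap_add, hm,
    Nat.cast_succ, add_sub_cancel_right]
  congr 2
  funext t
  simp [vecQ2]

/-- By definition of `vecQ2`, `𝐪^1 - 𝐪^2` is `2𝐪^1` plus a multiple of the curl-free `𝐯`. -/
lemma nMinus_succ {m : ℤ} {b : ℕ} (hm : m.natAbs = b + 1) (n : ℕ) :
    nMinus m (n + 1) = fun p => weightN p *ᵥ
      modeMap m (fun t => (2 : ℝ) • vecQ1 (n + 1) b t + (1 / (n + 1) : ℝ) • vecV n b t) p := by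
  have hm0 : m ≠ 0 := by rintro rfl; simp at hm
  funext p
  simp only [nMinus, n1, n2, vecN1, vecN2, if_neg hm0, if_neg n.succ_ne_zero,
    ← Matrix.mulVec_sub, modeMap_sub, hm, Nat.cast_succ, add_sub_cancel_right]
  congr 2
  funext t
  simp only [vecQ2, Pi.sub_apply, two_smul]
  abel

lemma nMinus_order_zero {m : ℤ} {b : ℕ} (hm : m.natAbs = b + 1) :
    nMinus m 0 = fun p => weightN p *ᵥ
      modeMap m (fun t => (2 : ℝ) • vecQ1 0 b t + (0 : ℝ) • vecV 0 b t) p := by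
  have hm0 : m ≠ 0 := by rintro rfl; simp at hm
  funext p
  simp only [nMinus, n1, vecN1, if_neg hm0, if_true, two_smul, ← Matrix.mulVec_add, modeMap_add,
    hm, Nat.cast_succ, add_sub_cancel_right]
  congr 2
  funext t
  simp

lemma curl_nMinus {m : ℤ} {b : ℕ} (hm : m.natAbs = b + 1) (j : ℕ) :
    Differentiable ℝ (nMinus m j) ∧ ∀ p, curl (nMinus m j) p
      = ((-(4 * (j + 1) * coeffQ j b) : ℝ) : ℂ) * Complex.I * (m.sign : ℂ) * zernike m j p := by
  rcases j with _ | n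
  · rw [nMinus_order_zero hm]
    exact curl_weightN_modeMap_vecQ1 hm 0 0 0
  · rw [nMinus_succ hm]
    exact curl_weightN_modeMap_vecQ1 hm (n + 1) n _

lemma mul_coeffQ (n b : ℕ) :
    4 * (n + 1) * coeffQ n b
      = 4 * (2 * n + b + 1) * (2 * n + b + 2) * (2 * n + b + 3) / frakR n b := by
  have h : frakR n b ≠ 0 := by
    rw [frakR]
    positivity
  rw [coeffQ]
  field_simp

end DiskVectorOP

end

theorem theorem7 :
    (∀ (m : ℤ) (j : ℕ), 1 ≤ j →
      Differentiable ℝ (DiskVectorOP.nPlus m j) ∧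
        ∀ p : ℝ × ℝ, DiskVectorOP.curl (DiskVectorOP.nPlus m j) p = 0) ∧
    (∀ j : ℕ, 1 ≤ j →
      Differentiable ℝ (DiskVectorOP.nMinus 0 j) ∧
        ∀ p : ℝ × ℝ, DiskVectorOP.curl (DiskVectorOP.nMinus 0 j) p
          = -4 * (j : ℂ) * DiskVectorOP.zernike 0 j p) ∧
    (∀ (m : ℤ) (j : ℕ), m ≠ 0 →
      Differentiable ℝ (DiskVectorOP.nMinus m j) ∧
        ∀ p : ℝ × ℝ, DiskVectorOP.curl (DiskVectorOP.nMinus m j) p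
          = -(4 * (2 * (j : ℂ) + (m.natAbs : ℂ)) * (2 * (j : ℂ) + (m.natAbs : ℂ) + 1)
                * (2 * (j : ℂ) + (m.natAbs : ℂ) + 2)
              / ((DiskVectorOP.frakR j ((m.natAbs : ℝ) - 1) : ℝ) : ℂ))
            * Complex.I * (m.sign : ℂ) * DiskVectorOP.zernike m j p) := by
  refine ⟨fun m j hj => ?_, fun j hj => ?_, fun m j hm => ?_⟩
  · obtain ⟨n, rfl⟩ := Nat.exists_eq_add_of_le' hj
    rcases eq_or_ne m 0 with rfl | hm
    · rw [DiskVectorOP.nPlus_zero]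
      exact DiskVectorOP.curl_radial _
    · obtain ⟨b, hb⟩ := Nat.exists_eq_succ_of_ne_zero (Int.natAbs_ne_zero.2 hm)
      rw [DiskVectorOP.nPlus_succ hb]
      exact DiskVectorOP.curl_weightN_modeMap_vecV hb n _
  · obtain ⟨n, rfl⟩ := Nat.exists_eq_add_of_le' hj
    rw [DiskVectorOP.nMinus_zero, Nat.add_sub_cancel]
    refine ⟨(DiskVectorOP.curl_azimuthal _).1, fun p => ?_⟩
    -- With `j = n + 1`, the factor `4` from the curl and `-(n+1)` from the derivative formula give
    -- `-4j`.
    rw [(DiskVectorOP.curl_azimuthal _).2 p,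
      DiskVectorOP.derivative_X_mul_one_sub_X_mul_shiftedJacobi, DiskVectorOP.zernike,
      DiskVectorOP.zernikeGen, ← DiskVectorOP.eval_shiftedJacobi, DiskVectorOP.radius_sq]
    simp [DiskVectorOP.harmonicY]
    ring
  · obtain ⟨b, hb⟩ := Nat.exists_eq_succ_of_ne_zero (Int.natAbs_ne_zero.2 hm)
    refine ⟨(DiskVectorOP.curl_nMinus hb j).1, fun p => ?_⟩
    rw [(DiskVectorOP.curl_nMinus hb j).2 p, DiskVectorOP.mul_coeffQ, hb, Nat.cast_succ,
      Nat.cast_succ, add_sub_cancel_right]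
    push_cast
    ring
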